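/- Let $A$ be a commutative Noetherian ring. For an ideal $I\subseteq A$, its integral closure $\overline{I}$ is the ideal of all $x\in A$ satisfying an equation $x^n+a_1x^{n-1}+\dots+a_n=0$ with $a_i\in I^i$ for $1\le i\le n$; $I$ is integrally closed if $\overline I=I$. Let $ic(A)$ be the commutative monoid of all integrally closed ideals of $A$ that contain a nonzerodivisor, with operation $I*J=\overline{IJ}$ and identity $A=(1)$. An atom of a commutative monoid $M$ with identity $1$ is an element $a\neq 1$ such that $a=xy$ implies $x=1$ or $y=1$; $M$ is atomic if it is generated by its atoms, and $M$ is a bounded factorization monoid if it is atomic and for each $m\in M$ the set $\{k : m=m_1\cdots m_k \text{ for atoms } m_i\}$ of lengths of factorizations of $m$ is finite. For a local ring $(A,\mathfrak m)$ and an ideal $I\subseteq A$ put $\mathrm{ord}_{\mathfrak m}(I)=\max\{n\in\mathbb N : I\subseteq \mathfrak m^n\}$, with $\mathrm{ord}_{\mathfrak m}(I)=\infty$ if there is no such maximum (as for $I=0$). **Theorem.** Let $(A,\mathfrak m)$ be a regular local ring. Then: 1. $ic(A)$ is a bounded factorization monoid; 2. $\mathrm{ord}_{\mathfrak m}(IJ)=\mathrm{ord}_{\mathfrak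 m}(I)+\mathrm{ord}_{\mathfrak m}(J)$ for all ideals $I,J\subseteq A$; 3. $\mathrm{ord}_{\mathfrak m}(\overline I)=\mathrm{ord}_{\mathfrak m}(I)$ for every ideal $I\subseteq A$; 4. $\mathrm{ord}_{\mathfrak m}$ is finite on $ic(A)$ and restricts to a monoid homomorphism $ic(A)\to(\mathbb N,+)$, and whenever $I=I_1*\dots*I_k$ in $ic(A)$ with atoms $I_1,\dots,I_k$, one has $k\le \mathrm{ord}_{\mathfrak m}(I)$. -/

import Mathlib

open Polynomial

namespace IntClosedIdeals

section Closure

variable {A : Type*} [CommRing A]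

/-- `x` is integral over the ideal `I`: it satisfies a monic equation
`x ^ n + a₁ * x ^ (n - 1) + ⋯ + aₙ = 0` with `aᵢ ∈ I ^ i` (the coefficient of `X ^ k` is
`a_{n - k}`). -/
def IsIntegralOver (I : Ideal A) (x : A) : Prop :=
  ∃ p : A[X], p.Monic ∧ (∀ k, p.coeff k ∈ I ^ (p.natDegree - k)) ∧ p.eval x = 0

/-- Auxiliary: `I` is a reduction of `J`. Used only to see that integral closures are ideals and
that they are compatible with products. -/
def IsReduction (I J : Ideal A) : Prop :=
  I ≤ J ∧ ∃ n : ℕ, J ^ (n + 1) ≤ I * J ^ n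

theorem IsReduction.refl (I : Ideal A) : IsReduction I I :=
  ⟨le_rfl, 0, by simp⟩

theorem IsReduction.pow_le {I J : Ideal A} {n : ℕ} (h : J ^ (n + 1) ≤ I * J ^ n) (m : ℕ) :
    J ^ (n + m) ≤ I ^ m * J ^ n := by
  induction m with
  | zero => simp
  | succ m ih =>
    calc J ^ (n + (m + 1)) = J ^ (n + m) * J := by rw [← add_assoc, pow_succ]
      _ ≤ (I ^ m * J ^ n) * J := Ideal.mul_mono_left ih
      _ = I ^ m * J ^ (n + 1) := by rw [mul_assoc, pow_succ]
      _ ≤ I ^ m * (I * J ^ n) := Ideal.mul_mono_right h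
      _ = I ^ (m + 1) * J ^ n := by rw [pow_succ, mul_assoc]

theorem IsReduction.le_of_le {I J : Ideal A} {n m : ℕ} (h : J ^ (n + 1) ≤ I * J ^ n)
    (hnm : n ≤ m) : J ^ (m + 1) ≤ I * J ^ m := by
  obtain ⟨k, rfl⟩ := Nat.exists_eq_add_of_le hnm
  calc J ^ (n + k + 1) = J ^ (n + 1) * J ^ k := by rw [← pow_add]; congr 1; ring
    _ ≤ (I * J ^ n) * J ^ k := Ideal.mul_mono_left h
    _ = I * J ^ (n + k) := by rw [mul_assoc, ← pow_add]

theorem IsReduction.trans {I J K : Ideal A} (h₁ : IsReduction I J) (h₂ : IsReduction J K) :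
    IsReduction I K := by
  obtain ⟨h₁, n, hn⟩ := h₁
  obtain ⟨h₂, m, hm⟩ := h₂
  refine ⟨h₁.trans h₂, m + n, ?_⟩
  calc K ^ (m + n + 1) = K ^ (m + (n + 1)) := by rw [add_assoc]
    _ ≤ J ^ (n + 1) * K ^ m := IsReduction.pow_le hm _
    _ ≤ (I * J ^ n) * K ^ m := Ideal.mul_mono_left hn
    _ ≤ (I * K ^ n) * K ^ m := Ideal.mul_mono_left (Ideal.mul_mono_right (Ideal.pow_right_mono h₂ n))
    _ = I * K ^ (m + n) := by rw [mul_assoc, ← pow_add, add_comm]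

theorem IsReduction.mul {I J K L : Ideal A} (h₁ : IsReduction I J) (h₂ : IsReduction K L) :
    IsReduction (I * K) (J * L) := by
  obtain ⟨h₁, n, hn⟩ := h₁
  obtain ⟨h₂, m, hm⟩ := h₂
  refine ⟨Ideal.mul_mono h₁ h₂, max n m, ?_⟩
  rw [mul_pow, mul_pow]
  calc _ ≤ (I * J ^ max n m) * (K * L ^ max n m) :=
        Ideal.mul_mono (IsReduction.le_of_le hn (le_max_left _ _))
          (IsReduction.le_of_le hm (le_max_right _ _))
    _ = _ := by ring

theorem sup_span_pow_le (I : Ideal A) (x : A) (n : ℕ) :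
    (I ⊔ Ideal.span {x}) ^ (n + 1) ≤
      I * (I ⊔ Ideal.span {x}) ^ n ⊔ Ideal.span {x ^ (n + 1)} := by
  induction n with
  | zero => simp
  | succ n ih =>
    set K := I ⊔ Ideal.span {x} with hK
    have hx : Ideal.span {x ^ (n + 1)} ≤ K ^ (n + 1) := by
      rw [← Ideal.span_singleton_pow]
      exact Ideal.pow_right_mono le_sup_right _
    calc K ^ (n + 1 + 1) = K ^ (n + 1) * K := pow_succ _ _
      _ ≤ (I * K ^ n ⊔ Ideal.span {x ^ (n + 1)}) * K := Ideal.mul_mono_left ih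
      _ = I * K ^ n * K ⊔ Ideal.span {x ^ (n + 1)} * K := Ideal.sup_mul _ _ _
      _ = I * K ^ (n + 1) ⊔
          (Ideal.span {x ^ (n + 1)} * I ⊔ Ideal.span {x ^ (n + 1)} * Ideal.span {x}) := by
            rw [mul_assoc, ← pow_succ, ← Ideal.mul_sup]
      _ ≤ _ := by
            refine sup_le le_sup_left (sup_le ?_ ?_)
            · rw [mul_comm]
              exact (Ideal.mul_mono_right hx).trans le_sup_left
            · rw [Ideal.span_singleton_mul_span_singleton, ← pow_succ]
              exact le_sup_right

theorem IsIntegralOver.isReduction {I : Ideal A} {x : A} (h : IsIntegralOver I x) :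
    IsReduction I (I ⊔ Ideal.span {x}) := by
  obtain ⟨p, hp, hc, hx⟩ := h
  refine ⟨le_sup_left, p.natDegree, (sup_span_pow_le I x _).trans (sup_le le_rfl ?_)⟩
  set K := I ⊔ Ideal.span {x} with hK
  have hxK : x ∈ K := Ideal.mem_sup_right (Ideal.mem_span_singleton_self x)
  rw [Ideal.span_singleton_le_iff_mem]
  rw [Polynomial.eval_eq_sum_range, Finset.sum_range_succ, hp.coeff_natDegree, one_mul] at hx
  have e : x ^ (p.natDegree + 1) =
      -∑ k ∈ Finset.range p.natDegree, p.coeff k * x ^ (k + 1) := by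
    have h2 : ∑ k ∈ Finset.range p.natDegree, p.coeff k * x ^ (k + 1) =
        (∑ k ∈ Finset.range p.natDegree, p.coeff k * x ^ k) * x := by
      rw [Finset.sum_mul]
      exact Finset.sum_congr rfl fun k _ ↦ by ring
    rw [h2]
    linear_combination x * hx
  rw [e]
  refine neg_mem (sum_mem fun k hk ↦ ?_)
  have hk : k < p.natDegree := Finset.mem_range.mp hk
  have h3 : I ^ (p.natDegree - k) * K ^ (k + 1) ≤ I * K ^ p.natDegree := by
    obtain ⟨j, hj⟩ : ∃ j, p.natDegree = k + (j + 1) := ⟨p.natDegree - k - 1, by omega⟩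
    have hjk : p.natDegree - k = j + 1 := by omega
    rw [hjk, hj, pow_succ', mul_assoc]
    refine Ideal.mul_mono_right ?_
    calc I ^ j * K ^ (k + 1) ≤ K ^ j * K ^ (k + 1) :=
          Ideal.mul_mono_left (Ideal.pow_right_mono le_sup_left j)
      _ = K ^ (k + (j + 1)) := by rw [← pow_add]; congr 1; ring
  exact h3 (Ideal.mul_mem_mul (hc k) (Ideal.pow_mem_pow hxK _))

theorem IsReduction.isIntegralOver [IsNoetherianRing A] {I J : Ideal A} (h : IsReduction I J)
    {z : A} (hz : z ∈ J) : IsIntegralOver I z := by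
  obtain ⟨-, n, hn⟩ := h
  let f : Module.End A ↥(J ^ n) := algebraMap A (Module.End A ↥(J ^ n)) z
  have hf : LinearMap.range f ≤ I • ⊤ := by
    rintro _ ⟨w, rfl⟩
    have h1 : z * (w : A) ∈ I * J ^ n := by
      refine hn ?_
      rw [pow_succ']
      exact Ideal.mul_mem_mul hz w.2
    have h2 : (I • (⊤ : Submodule A ↥(J ^ n))).map (J ^ n).subtype = I * J ^ n := by
      rw [Submodule.map_smul'', Submodule.map_top, Submodule.range_subtype, smul_eq_mul]
    rw [← h2] at h1
    obtain ⟨v, hv, hvz⟩ := h1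
    have : f w = v := by
      apply Subtype.ext
      refine Eq.trans ?_ hvz.symm
      simp [f]
    rw [this]
    exact hv
  obtain ⟨p, hp, -, hc, hpf⟩ :=
    LinearMap.exists_monic_and_natDegree_eq_and_coeff_mem_pow_and_aeval_eq_zero A f I hf
  have hz0 : p.eval z * z ^ n = 0 := by
    have h1 : aeval f p = algebraMap A (Module.End A ↥(J ^ n)) (p.eval z) := by
      rw [Polynomial.aeval_algebraMap_apply]
      simp
    rw [h1] at hpf
    have h2 := congrArg Subtype.val
      (LinearMap.congr_fun hpf (⟨z ^ n, Ideal.pow_mem_pow hz n⟩ : ↥(J ^ n)))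
    simpa using h2
  rcases subsingleton_or_nontrivial A with hA | hA
  · exact ⟨1, monic_one, fun k ↦ by rw [Subsingleton.elim (coeff _ _) 0]; exact zero_mem _,
      Subsingleton.elim _ _⟩
  refine ⟨p * X ^ n, hp.mul (monic_X_pow n), fun k ↦ ?_, by simpa using hz0⟩
  rw [hp.natDegree_mul (monic_X_pow n), natDegree_X_pow, coeff_mul_X_pow']
  split_ifs with hk
  · have e : p.natDegree + n - k = p.natDegree - (k - n) := by omega
    rw [e]
    exact hc _
  · exact zero_mem _

theorem isIntegralOver_of_mem {I : Ideal A} {x : A} (hx : x ∈ I) : IsIntegralOver I x := by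
  rcases subsingleton_or_nontrivial A with hA | hA
  · exact ⟨1, monic_one, fun k ↦ by rw [Subsingleton.elim (coeff _ _) 0]; exact zero_mem _,
      Subsingleton.elim _ _⟩
  refine ⟨X - C x, monic_X_sub_C x, fun k ↦ ?_, by simp⟩
  rw [natDegree_X_sub_C]
  rcases k with _ | k
  · simpa using hx
  · simp

theorem exists_reduction_of_two [IsNoetherianRing A] {I : Ideal A} {x y : A}
    (hx : IsIntegralOver I x) (hy : IsIntegralOver I y) :
    ∃ J, IsReduction I J ∧ x ∈ J ∧ y ∈ J := by
  have h1 := hx.isReduction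
  have hy' : IsIntegralOver (I ⊔ Ideal.span {x}) y := by
    obtain ⟨p, hp, hc, h⟩ := hy
    exact ⟨p, hp, fun k ↦ Ideal.pow_right_mono le_sup_left _ (hc k), h⟩
  refine ⟨_, h1.trans hy'.isReduction, ?_, ?_⟩
  · exact Ideal.mem_sup_left (Ideal.mem_sup_right (Ideal.mem_span_singleton_self x))
  · exact Ideal.mem_sup_right (Ideal.mem_span_singleton_self y)

variable [IsNoetherianRing A]

/-- The integral closure of an ideal of a commutative Noetherian ring. -/
def intClosure (I : Ideal A) : Ideal A where
  carrier := {x | IsIntegralOver I x}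
  zero_mem' := isIntegralOver_of_mem (zero_mem I)
  add_mem' := fun hx hy ↦ by
    obtain ⟨J, hJ, h1, h2⟩ := exists_reduction_of_two hx hy
    exact hJ.isIntegralOver (add_mem h1 h2)
  smul_mem' := fun c x hx ↦
    IsReduction.isIntegralOver (IsIntegralOver.isReduction hx)
      (Ideal.mul_mem_left _ c (Ideal.mem_sup_right (Ideal.mem_span_singleton_self x)))

theorem mem_intClosure {I : Ideal A} {x : A} : x ∈ intClosure I ↔ IsIntegralOver I x :=
  Iff.rfl

theorem le_intClosure (I : Ideal A) : I ≤ intClosure I :=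
  fun _ hx ↦ isIntegralOver_of_mem hx

theorem intClosure_mono {I J : Ideal A} (h : I ≤ J) : intClosure I ≤ intClosure J := by
  rintro x ⟨p, hp, hc, hx⟩
  exact ⟨p, hp, fun k ↦ Ideal.pow_right_mono h _ (hc k), hx⟩

theorem isReduction_intClosure (I : Ideal A) : IsReduction I (intClosure I) := by
  have key : ∀ J : Ideal A, J.FG → J ≤ intClosure I → IsReduction I (I ⊔ J) := by
    intro J hJ
    induction J, hJ using Submodule.fg_induction with
    | singleton x =>
      intro h
      exact IsIntegralOver.isReduction (h (Ideal.mem_span_singleton_self x))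
    | sup J₁ J₂ _ _ h₁ h₂ =>
      intro h
      obtain ⟨hl₁, n, hn⟩ := h₁ (le_sup_left.trans h)
      obtain ⟨hl₂, m, hm⟩ := h₂ (le_sup_right.trans h)
      have hmn : IsReduction (I ⊔ J₁) ((I ⊔ J₁) ⊔ (I ⊔ J₂)) := by
        refine ⟨le_sup_left, m, ?_⟩
        set P := I ⊔ J₁
        set Q := I ⊔ J₂
        have hIP : I ≤ P := hl₁
        have hQP : ∀ k, (P ⊔ Q) ^ (k + 1) ≤ P * (P ⊔ Q) ^ k ⊔ Q ^ (k + 1) := by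
          intro k
          induction k with
          | zero => simp
          | succ k ih =>
            calc (P ⊔ Q) ^ (k + 1 + 1) = (P ⊔ Q) * (P ⊔ Q) ^ (k + 1) := pow_succ' _ _
              _ = P * (P ⊔ Q) ^ (k + 1) ⊔ Q * (P ⊔ Q) ^ (k + 1) := Ideal.sup_mul _ _ _
              _ ≤ P * (P ⊔ Q) ^ (k + 1) ⊔ Q * (P * (P ⊔ Q) ^ k ⊔ Q ^ (k + 1)) :=
                  sup_le_sup le_rfl (Ideal.mul_mono_right ih)
              _ ≤ _ := by
                  refine sup_le le_sup_left ?_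
                  rw [Ideal.mul_sup]
                  refine sup_le ?_ ?_
                  · rw [mul_left_comm, pow_succ']
                    exact (Ideal.mul_mono_right (Ideal.mul_mono_left le_sup_right)).trans
                      le_sup_left
                  · rw [← pow_succ']
                    exact le_sup_right
        refine (hQP m).trans (sup_le le_rfl (hm.trans ?_))
        exact Ideal.mul_mono hIP (Ideal.pow_right_mono le_sup_right _)
      have e : I ⊔ (J₁ ⊔ J₂) = (I ⊔ J₁) ⊔ (I ⊔ J₂) := sup_sup_distrib_left _ _ _
      rw [e]
      exact IsReduction.trans ⟨hl₁, n, hn⟩ hmn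
  have h := key (intClosure I) (IsNoetherian.noetherian _) le_rfl
  rwa [sup_eq_right.mpr (le_intClosure I)] at h

theorem IsReduction.le_intClosure {I J : Ideal A} (h : IsReduction I J) : J ≤ intClosure I :=
  fun _ hx ↦ h.isIntegralOver hx

theorem intClosure_idem (I : Ideal A) : intClosure (intClosure I) = intClosure I :=
  le_antisymm
    ((isReduction_intClosure I).trans (isReduction_intClosure _)).le_intClosure
    (le_intClosure _)

theorem intClosure_intClosure_mul (I J : Ideal A) :
    intClosure (intClosure I * J) = intClosure (I * J) :=
  le_antisymm
    (((isReduction_intClosure I).mul (IsReduction.refl J)).trans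
      (isReduction_intClosure _)).le_intClosure
    (intClosure_mono (Ideal.mul_mono_left (le_intClosure I)))

end Closure

section Monoid

/-- `ic(A)`: the integrally closed ideals of `A` that contain a nonzerodivisor. -/
def IC (A : Type*) [CommRing A] [IsNoetherianRing A] : Type _ :=
  {I : Ideal A // intClosure I = I ∧ ∃ x ∈ I, x ∈ nonZeroDivisors A}

variable {A : Type*} [CommRing A] [IsNoetherianRing A]

/-- The underlying ideal of an element of `ic(A)`. -/
def IC.toIdeal (I : IC A) : Ideal A := I.1

/-- The monoid structure `I * J = intClosure (I J)` on `ic(A)`, with identity the unit ideal. -/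
instance : CommMonoid (IC A) where
  mul I J := ⟨intClosure (I.1 * J.1), intClosure_idem _, by
    obtain ⟨x, hx, hx0⟩ := I.2.2
    obtain ⟨y, hy, hy0⟩ := J.2.2
    exact ⟨x * y, le_intClosure _ (Ideal.mul_mem_mul hx hy), mul_mem hx0 hy0⟩⟩
  one := ⟨⊤, top_le_iff.mp (le_intClosure _), 1, trivial, one_mem _⟩
  mul_assoc I J K := Subtype.ext <| by
    change intClosure (intClosure (I.1 * J.1) * K.1) = intClosure (I.1 * intClosure (J.1 * K.1))
    rw [intClosure_intClosure_mul, mul_comm I.1 (intClosure _), intClosure_intClosure_mul,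
      mul_comm (J.1 * K.1), mul_assoc]
  one_mul I := Subtype.ext <| by
    change intClosure (⊤ * I.1) = I.1
    rw [Ideal.top_mul, I.2.1]
  mul_one I := Subtype.ext <| by
    change intClosure (I.1 * ⊤) = I.1
    rw [Ideal.mul_top, I.2.1]
  mul_comm I J := Subtype.ext <| by
    change intClosure (I.1 * J.1) = intClosure (J.1 * I.1)
    rw [mul_comm]

theorem IC.toIdeal_mul (I J : IC A) : (I * J).toIdeal = intClosure (I.toIdeal * J.toIdeal) := rfl

theorem IC.toIdeal_one : (1 : IC A).toIdeal = ⊤ := rfl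

/-- An atom of a commutative monoid: a non-identity element that is a product of two elements only
if one of them is the identity. In `ic(A)` these are the `*`-irreducible ideals. -/
def IsMonoidAtom {M : Type*} [CommMonoid M] (a : M) : Prop :=
  a ≠ 1 ∧ ∀ x y : M, a = x * y → x = 1 ∨ y = 1

/-- `s` is a factorization of `m` into atoms (its length is `s.card`). -/
def IsAtomFactorization {M : Type*} [CommMonoid M] (m : M) (s : Multiset M) : Prop :=
  (∀ a ∈ s, IsMonoidAtom a) ∧ s.prod = m

/-- A monoid is atomic if it is generated by its atoms. -/
def IsAtomicMonoid (M : Type*) [CommMonoid M] : Prop :=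
  Submonoid.closure {a : M | IsMonoidAtom a} = ⊤

/-- The set `L(m)` of lengths of the factorizations of `m` into atoms. -/
def lengthSet {M : Type*} [CommMonoid M] (m : M) : Set ℕ :=
  {k | ∃ s : Multiset M, IsAtomFactorization m s ∧ s.card = k}

/-- A bounded factorization monoid (BFM). -/
def IsBFM (M : Type*) [CommMonoid M] : Prop :=
  IsAtomicMonoid M ∧ ∀ m : M, (lengthSet m).Finite

end Monoid

/-- The `𝔪`-adic order `max {n | I ⊆ 𝔪 ^ n}` of an ideal of a local ring `(A, 𝔪)`, with value `⊤`
if there is no largest such `n` (as for the zero ideal). -/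
noncomputable def adicOrder {A : Type*} [CommRing A] [IsLocalRing A] (I : Ideal A) : ℕ∞ :=
  ⨆ (n : ℕ) (_ : I ≤ IsLocalRing.maximalIdeal A ^ n), (n : ℕ∞)

end IntClosedIdeals

/-! ### Forms in generators of the maximal ideal; the graded ring of a regular local ring. -/

open IsLocalRing

/-! Everything rests on the additivity of the order, that is, on the associated graded ring being a
domain: minimal generators of `𝔪` satisfy no form modulo higher order unless its coefficients lie in
`𝔪` (`map_residue_eq_zero_of_eval_mem`), so leading forms multiply as in a polynomial ring over a
field. A nontrivial relation would, at a point where the form is nonzero, make `𝔪` minimal over an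
ideal with too few generators, against Krull's height theorem; such a point exists after enlarging
the residue field.

Since `I` is a reduction of its closure `J`, `J ^ (n + 1) ≤ I * J ^ n`, and additivity lets `J ^ n`
be cancelled: closure preserves order. Thus the order is a homomorphism on `ic(A)` that vanishes
only at the identity, and such a length function bounds all factorizations. -/

theorem MvPolynomial.IsHomogeneous.eval_const_mul {R σ : Type*} [CommRing R]
    {F : MvPolynomial σ R} {n : ℕ} (hF : F.IsHomogeneous n) (r : R) (c : σ → R) :
    MvPolynomial.eval (fun i ↦ r * c i) F = r ^ n * MvPolynomial.eval c F := by
  simp only [MvPolynomial.eval_eq, Finset.mul_sum]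
  refine Finset.sum_congr rfl fun e he ↦ ?_
  have h : n = ∑ i ∈ e.support, e i := hF.degree_eq_sum_deg_support he
  simp only [mul_pow, Finset.prod_mul_distrib]
  rw [Finset.prod_pow_eq_pow_sum, ← h]
  ring

namespace IntClosedIdeals

/-- Over an infinite residue field, a form of degree `n` evaluated at a system of parameters
generating the maximal ideal lies in `𝔪 ^ (n + 1)` only if all its coefficients lie in `𝔪`. -/
theorem map_residue_eq_zero_of_infinite {R ι : Type*} [CommRing R] [IsLocalRing R]
    [IsNoetherianRing R] [Infinite (ResidueField R)] [Finite ι] {x : ι → R}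
    (hx : Ideal.span (Set.range x) = maximalIdeal R)
    (hcard : (Nat.card ι : ℕ∞) ≤ (maximalIdeal R).height) {F : MvPolynomial ι R} {n : ℕ}
    (hF : F.IsHomogeneous n) (h : MvPolynomial.eval x F ∈ maximalIdeal R ^ (n + 1)) :
    MvPolynomial.map (residue R) F = 0 := by
  have hFm := hF.map (residue R)
  -- A constant form may be nonzero at the origin, so degree 0 is separate; below, the degree is `n
  -- + 1`.
  rcases n with _ | n
  · rw [← MvPolynomial.totalDegree_zero_iff_isHomogeneous,
      MvPolynomial.totalDegree_eq_zero_iff_eq_C] at hF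
    rw [hF] at h ⊢
    simp only [MvPolynomial.eval_C, zero_add, pow_one] at h
    rw [MvPolynomial.map_C, (residue_eq_zero_iff _).2 h, map_zero]
  by_contra hne
  obtain ⟨c, hc⟩ : ∃ c, MvPolynomial.eval c (MvPolynomial.map (residue R) F) ≠ 0 := by
    by_contra! H
    exact hne (hFm.eq_zero_of_forall_eval_eq_zero H)
  obtain ⟨j, hj⟩ : ∃ j, c j ≠ 0 := by
    by_contra! H
    refine hc ?_
    have := hFm.eval_const_mul 0 c
    rw [zero_pow n.succ_ne_zero, zero_mul] at this
    rw [← this]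
    congr 2
    ext i
    simp [H i]
  choose e he using residue_surjective (R := R)
  set u : ι → R := fun i ↦ e (c i) with hu
  have hru : ∀ i, residue R (u i) = c i := fun i ↦ he _
  have huj : IsUnit (u j) := by
    rw [← residue_ne_zero_iff_isUnit, hru]
    exact hj
  have hFu : IsUnit (MvPolynomial.eval u F) := by
    rw [← residue_ne_zero_iff_isUnit]
    convert hc using 1
    rw [MvPolynomial.eval_map, MvPolynomial.eval, MvPolynomial.coe_eval₂Hom,
      MvPolynomial.hom_eval₂, RingHom.comp_id]
    congr 1
    ext i
    exact hru i
  -- The `y i` are linear forms cutting out the line through `u`. As `y j = 0` and `u j` is a unit,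
  -- the other `y i` together with `x j` generate `𝔪`.
  set y : ι → R := fun i ↦ u j * x i - u i * x j with hy
  set Y : Ideal R := Ideal.span (y '' {j}ᶜ) with hY
  have hyY : ∀ i, y i ∈ Y := fun i ↦ by
    by_cases hij : i = j
    · simp [hy, hij]
    · exact Ideal.subset_span ⟨i, hij, rfl⟩
  have hYm : Y ≤ maximalIdeal R := by
    rw [hY, Ideal.span_le]
    rintro _ ⟨i, -, rfl⟩
    have hxm : ∀ i, x i ∈ maximalIdeal R := fun i ↦ hx ▸ Ideal.subset_span ⟨i, rfl⟩
    exact sub_mem (Ideal.mul_mem_left _ _ (hxm i)) (Ideal.mul_mem_left _ _ (hxm j))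
  have hm : maximalIdeal R = Y ⊔ Ideal.span {x j} := by
    refine le_antisymm ?_ (sup_le hYm ?_)
    · rw [← hx, Ideal.span_le]
      rintro _ ⟨i, rfl⟩
      rw [SetLike.mem_coe, ← Ideal.unit_mul_mem_iff_mem _ huj]
      have : u j * x i = y i + u i * x j := by simp [hy]
      rw [this]
      exact add_mem (Ideal.mem_sup_left (hyY i))
        (Ideal.mem_sup_right (Ideal.mul_mem_left _ _ (Ideal.mem_span_singleton_self _)))
    · rw [Ideal.span_singleton_le_iff_mem, ← hx]
      exact Ideal.subset_span ⟨j, rfl⟩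
  have hxj : x j ^ (n + 1) ∈ Y ⊔ maximalIdeal R ^ (n + 1 + 1) := by
    rw [← Ideal.unit_mul_mem_iff_mem _ hFu, mul_comm]
    -- Modulo `Y`, `u j • x` and `x j • u` agree; homogeneity pulls out the scalars.
    have h1 : u j ^ (n + 1) * MvPolynomial.eval x F -
        x j ^ (n + 1) * MvPolynomial.eval u F ∈ Y := by
      rw [← hF.eval_const_mul, ← hF.eval_const_mul, ← Ideal.Quotient.eq]
      simp only [MvPolynomial.eval, MvPolynomial.coe_eval₂Hom, MvPolynomial.hom_eval₂]
      congr 1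
      ext i
      refine Ideal.Quotient.eq.2 ?_
      convert hyY i using 1
      simp only [hy]
      ring
    rw [← sub_sub_cancel (u j ^ (n + 1) * MvPolynomial.eval x F)
      (x j ^ (n + 1) * MvPolynomial.eval u F)]
    exact sub_mem (Ideal.mem_sup_right (Ideal.mul_mem_left _ _ h)) (Ideal.mem_sup_left h1)
  -- Nakayama, from `𝔪 ^ (n + 1) ≤ Y + 𝔪 ^ (n + 2)`.
  have hmY : maximalIdeal R ^ (n + 1) ≤ Y := by
    refine Submodule.le_of_le_smul_of_le_jacobson_bot (I := maximalIdeal R)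
      (IsNoetherian.noetherian _) (jacobson_eq_maximalIdeal _ bot_ne_top).ge ?_
    rw [smul_eq_mul, ← pow_succ']
    have h2 := sup_span_pow_le Y (x j) n
    rw [← hm] at h2
    refine h2.trans (sup_le (Ideal.mul_le_left.trans le_sup_left) ?_)
    rwa [Ideal.span_singleton_le_iff_mem]
  have hmin : maximalIdeal R ∈ Y.minimalPrimes := by
    refine ⟨⟨inferInstance, hYm⟩, fun q hq _ ↦ ?_⟩
    exact hq.1.le_of_pow_le (hmY.trans hq.2)
  -- Krull's height theorem: `𝔪` is minimal over `Y`, which has at most `Nat.card ι - 1` generators.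
  have hle := hcard.trans
    (Ideal.height_le_card_of_mem_minimalPrimes_span (Set.toFinite _) hmin)
  have h3 := Set.ncard_image_le (f := y) (Set.toFinite ({j}ᶜ : Set ι))
  have h4 := Set.ncard_add_ncard_compl ({j} : Set ι)
  rw [Set.ncard_singleton] at h4
  have h5 : Nat.card ι ≤ _ := Nat.cast_le.mp hle
  omega

/-- A system of parameters generating the maximal ideal is quasi-regular. -/
theorem map_residue_eq_zero_of_eval_mem {R ι : Type*} [CommRing R] [IsLocalRing R]
    [IsNoetherianRing R] [Finite ι] {x : ι → R}
    (hx : Ideal.span (Set.range x) = maximalIdeal R)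
    (hcard : (Nat.card ι : ℕ∞) ≤ (maximalIdeal R).height) {F : MvPolynomial ι R} {n : ℕ}
    (hF : F.IsHomogeneous n) (h : MvPolynomial.eval x F ∈ maximalIdeal R ^ (n + 1)) :
    MvPolynomial.map (residue R) F = 0 := by
  -- Pass to `R[X]` localized at `𝔪 R[X]`: the height and the generators of the maximal ideal
  -- persist, while the powers of `X` stay distinct in the residue field.
  let P : Ideal R[X] := (maximalIdeal R).map C
  have : P.IsPrime := Ideal.isPrime_map_C_of_isPrime
  let B := Localization.AtPrime P
  let f : R →+* B := (algebraMap R[X] B).comp C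
  have hmap : (maximalIdeal R).map f = maximalIdeal B := by
    rw [← Ideal.map_map]
    exact Localization.AtPrime.map_eq_maximalIdeal
  have hP : ∀ p : R[X], algebraMap R[X] B p ∈ maximalIdeal B ↔ p ∈ P := fun p ↦
    IsLocalization.AtPrime.to_map_mem_maximal_iff B P p
  have hht : (maximalIdeal B).height = (maximalIdeal R).height := by
    rw [← IsLocalization.height_under P.primeCompl, Localization.AtPrime.under_maximalIdeal]
    exact Polynomial.height_map_C _
  have : Infinite (ResidueField B) := by
    refine Infinite.of_injective (fun i : ℕ ↦ residue B (algebraMap R[X] B (X ^ i)))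
      fun i k hik ↦ ?_
    by_contra hne
    have h1 : residue B (algebraMap R[X] B (X ^ i - X ^ k)) = 0 := by
      rw [map_sub, map_sub]
      exact sub_eq_zero.2 hik
    rw [residue_eq_zero_iff, hP, Ideal.mem_map_C_iff] at h1
    have h2 := h1 i
    rw [coeff_sub, coeff_X_pow_self, coeff_X_pow, if_neg hne, sub_zero] at h2
    exact (Ideal.ne_top_iff_one _).1 (maximalIdeal.isMaximal R).ne_top h2
  have hxB : Ideal.span (Set.range (f ∘ x)) = maximalIdeal B := by
    rw [Set.range_comp, ← Ideal.map_span, hx, hmap]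
  have hev : MvPolynomial.eval (f ∘ x) (MvPolynomial.map f F) ∈ maximalIdeal B ^ (n + 1) := by
    rw [MvPolynomial.eval_map, ← hmap, ← Ideal.map_pow]
    have := Ideal.mem_map_of_mem f h
    rwa [MvPolynomial.eval, MvPolynomial.coe_eval₂Hom, MvPolynomial.hom_eval₂,
      RingHom.comp_id] at this
  have hz := map_residue_eq_zero_of_infinite hxB (hht ▸ hcard) (hF.map f) hev
  ext e
  have hz' := congrArg (MvPolynomial.coeff e) hz
  simp only [MvPolynomial.coeff_map, MvPolynomial.coeff_zero] at hz' ⊢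
  rw [residue_eq_zero_iff] at hz' ⊢
  have h1 := (hP _).1 hz'
  rw [Ideal.mem_map_C_iff] at h1
  simpa using h1 0

/-- The associated graded ring of a regular local ring has no zero divisors. -/
theorem mul_notMem_maximalIdeal_pow {A : Type*} [CommRing A] [IsRegularLocalRing A] {a b : A}
    {s t : ℕ} (ha : a ∈ maximalIdeal A ^ s) (ha' : a ∉ maximalIdeal A ^ (s + 1))
    (hb : b ∈ maximalIdeal A ^ t) (hb' : b ∉ maximalIdeal A ^ (t + 1)) :
    a * b ∉ maximalIdeal A ^ (s + t + 1) := by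
  have hfg : Submodule.FG (maximalIdeal A) := IsNoetherian.noetherian _
  have : Finite (maximalIdeal A).generators := hfg.finite_generators
  let x : (maximalIdeal A).generators → A := Subtype.val
  have hx : Ideal.span (Set.range x) = maximalIdeal A := by
    rw [Subtype.range_coe]
    exact (maximalIdeal A).span_generators
  -- Regularity enters here: the minimal number of generators of `𝔪` is the dimension.
  have hcard : (Nat.card (maximalIdeal A).generators : ℕ∞) ≤ (maximalIdeal A).height := by
    have h1 : ((maximalIdeal A).height : WithBot ℕ∞) = _ :=
      maximalIdeal_height_eq_ringKrullDim (R := A)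
    rw [← IsRegularLocalRing.spanFinrank_maximalIdeal, ← hfg.generators_ncard] at h1
    exact (WithBot.coe_injective h1).ge
  have hmem : ∀ {n : ℕ} {F : MvPolynomial (maximalIdeal A).generators A}, F.IsHomogeneous n →
      MvPolynomial.map (residue A) F = 0 → MvPolynomial.eval x F ∈ maximalIdeal A ^ (n + 1) := by
    intro n F hF hF0
    rw [MvPolynomial.eval_eq]
    refine sum_mem fun e he ↦ ?_
    rw [pow_succ']
    refine Ideal.mul_mem_mul ?_ ?_
    · rw [← residue_eq_zero_iff, ← MvPolynomial.coeff_map, hF0, MvPolynomial.coeff_zero]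
    · rw [hF.degree_eq_sum_deg_support he, ← Finset.prod_pow_eq_pow_sum]
      exact Ideal.prod_mem_prod fun i _ ↦
        Ideal.pow_mem_pow (hx ▸ Ideal.subset_span ⟨i, rfl⟩) _
  rw [← hx, Ideal.mem_span_pow_iff_exists_isHomogeneous] at ha hb
  obtain ⟨F, hF, rfl⟩ := ha
  obtain ⟨G, hG, rfl⟩ := hb
  intro h
  rw [← map_mul] at h
  have h0 := map_residue_eq_zero_of_eval_mem hx hcard (hF.mul hG) h
  rw [map_mul, mul_eq_zero] at h0
  exact h0.elim (fun h ↦ ha' (hmem hF h)) (fun h ↦ hb' (hmem hG h))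

/-! ### The adic order: additivity and invariance under integral closure. -/

section Order

variable {A : Type*} [CommRing A]

/-- The powers of `𝔪` decrease, so the exponents `n` with `I ≤ 𝔪 ^ n` form an initial segment. -/
theorem le_adicOrder_iff [IsLocalRing A] {I : Ideal A} {n : ℕ} :
    (n : ℕ∞) ≤ adicOrder I ↔ I ≤ maximalIdeal A ^ n := by
  refine ⟨fun h ↦ ?_, fun h ↦ le_iSup₂_of_le n h le_rfl⟩
  by_contra hI
  have hle : adicOrder I ≤ (n - 1 : ℕ) := by
    refine iSup₂_le fun k hk ↦ ?_
    have hkn : k < n := by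
      by_contra! hnk
      exact hI (hk.trans (Ideal.pow_le_pow_right hnk))
    exact_mod_cast Nat.le_sub_one_of_lt hkn
  have hn : n ≤ n - 1 := by exact_mod_cast h.trans hle
  obtain rfl : n = 0 := by omega
  exact hI (by simp)

theorem adicOrder_antitone [IsLocalRing A] {I J : Ideal A} (h : I ≤ J) :
    adicOrder J ≤ adicOrder I :=
  ENat.forall_natCast_le_iff_le.1 fun _ hn ↦
    le_adicOrder_iff.2 (h.trans (le_adicOrder_iff.1 hn))

theorem adicOrder_top [IsLocalRing A] : adicOrder (⊤ : Ideal A) = 0 := by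
  by_contra h
  have h1 : ((1 : ℕ) : ℕ∞) ≤ adicOrder (⊤ : Ideal A) := by
    exact_mod_cast Order.one_le_iff_ne_zero.2 h
  rw [le_adicOrder_iff, pow_one] at h1
  exact (maximalIdeal.isMaximal A).ne_top (top_le_iff.1 h1)

theorem adicOrder_eq_zero_iff [IsLocalRing A] {I : Ideal A} : adicOrder I = 0 ↔ I = ⊤ := by
  refine ⟨fun h ↦ ?_, fun h ↦ h ▸ adicOrder_top⟩
  by_contra hI
  have h1 : ((1 : ℕ) : ℕ∞) ≤ adicOrder I := by
    rw [le_adicOrder_iff, pow_one]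
    exact le_maximalIdeal hI
  simp [h] at h1

/-- Krull's intersection theorem. -/
theorem adicOrder_eq_top_iff [IsLocalRing A] [IsNoetherianRing A] {I : Ideal A} :
    adicOrder I = ⊤ ↔ I = ⊥ := by
  rw [← top_le_iff, ← ENat.forall_natCast_le_iff_le, eq_bot_iff,
    ← Ideal.iInf_pow_eq_bot_of_isLocalRing _ (maximalIdeal.isMaximal A).ne_top, le_iInf_iff]
  simp [le_adicOrder_iff]

variable [IsRegularLocalRing A]

theorem adicOrder_mul (I J : Ideal A) :
    adicOrder (I * J) = adicOrder I + adicOrder J := by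
  rcases eq_or_ne (adicOrder I) ⊤ with hI | hI
  · rw [adicOrder_eq_top_iff] at hI
    rw [hI, Ideal.bot_mul, adicOrder_eq_top_iff.2 rfl, top_add]
  rcases eq_or_ne (adicOrder J) ⊤ with hJ | hJ
  · rw [adicOrder_eq_top_iff] at hJ
    rw [hJ, Ideal.mul_bot, adicOrder_eq_top_iff.2 rfl, add_top]
  lift adicOrder I to ℕ using hI with s hs
  lift adicOrder J to ℕ using hJ with t ht
  have key : ∀ {K : Ideal A} {r : ℕ}, (r : ℕ∞) = adicOrder K →
      ∃ a ∈ K, a ∈ maximalIdeal A ^ r ∧ a ∉ maximalIdeal A ^ (r + 1) := by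
    intro K r hr
    have h1 : ¬ K ≤ maximalIdeal A ^ (r + 1) := by
      rw [← le_adicOrder_iff, ← hr]
      exact_mod_cast Nat.not_succ_le_self r
    obtain ⟨a, ha, ha'⟩ := SetLike.not_le_iff_exists.1 h1
    exact ⟨a, ha, le_adicOrder_iff.1 hr.le ha, ha'⟩
  refine le_antisymm ?_ ?_
  · obtain ⟨a, ha, ha1, ha2⟩ := key hs
    obtain ⟨b, hb, hb1, hb2⟩ := key ht
    by_contra! hlt
    have h1 : ((s + t + 1 : ℕ) : ℕ∞) ≤ adicOrder (I * J) := by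
      push_cast
      exact Order.add_one_le_of_lt hlt
    exact mul_notMem_maximalIdeal_pow ha1 ha2 hb1 hb2
      (le_adicOrder_iff.1 h1 (Ideal.mul_mem_mul ha hb))
  · rw [← Nat.cast_add, le_adicOrder_iff, pow_add]
    exact Ideal.mul_mono (le_adicOrder_iff.1 hs.le) (le_adicOrder_iff.1 ht.le)

theorem adicOrder_pow (I : Ideal A) (n : ℕ) : adicOrder (I ^ n) = n * adicOrder I := by
  induction n with
  | zero => simp [adicOrder_top]
  | succ n ih => rw [pow_succ, adicOrder_mul, ih, Nat.cast_succ, add_mul, one_mul]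

theorem IsReduction.adicOrder_eq {I J : Ideal A} (h : IsReduction I J) :
    adicOrder J = adicOrder I := by
  obtain ⟨hIJ, n, hn⟩ := h
  refine le_antisymm (adicOrder_antitone hIJ) ?_
  have h1 := adicOrder_antitone hn
  rw [adicOrder_mul, pow_succ', adicOrder_mul, adicOrder_pow] at h1
  -- Here `h1` reads `ord I + n * ord J ≤ ord J + n * ord J`; cancelling needs `ord J` finite.
  rcases eq_or_ne (adicOrder J) ⊤ with hJ | hJ
  · rw [hJ]
    exact le_top
  · exact (ENat.add_le_add_iff_right (WithTop.mul_ne_top (ENat.natCast_ne_top n) hJ)).1 h1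

theorem adicOrder_intClosure (I : Ideal A) : adicOrder (intClosure I) = adicOrder I :=
  (isReduction_intClosure I).adicOrder_eq

theorem IC.adicOrder_ne_top (I : IC A) : adicOrder I.toIdeal ≠ ⊤ := by
  rw [Ne, adicOrder_eq_top_iff]
  obtain ⟨x, hx, hx0⟩ := I.2.2
  intro h
  refine nonZeroDivisors.ne_zero hx0 ?_
  rw [← Ideal.mem_bot, ← h]
  exact hx

/-- The adic order as a monoid homomorphism on the integrally closed ideals. -/
noncomputable def IC.order (A : Type*) [CommRing A] [IsRegularLocalRing A] :
    IC A →* Multiplicative ℕ where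
  toFun I := Multiplicative.ofAdd (adicOrder I.toIdeal).toNat
  map_one' := by rw [IC.toIdeal_one, adicOrder_top]; rfl
  map_mul' I J := by
    rw [IC.toIdeal_mul, adicOrder_intClosure, adicOrder_mul,
      ENat.toNat_add I.adicOrder_ne_top J.adicOrder_ne_top, ofAdd_add]

theorem IC.coe_order (I : IC A) :
    ((IC.order A I).toAdd : ℕ∞) = adicOrder I.toIdeal :=
  ENat.natCast_toNat I.adicOrder_ne_top

theorem IC.eq_one_of_order_eq_one {I : IC A} (h : IC.order A I = 1) : I = 1 := by
  have h1 := I.coe_order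
  rw [h, toAdd_one, Nat.cast_zero] at h1
  exact Subtype.ext (adicOrder_eq_zero_iff.1 h1.symm)

end Order

/-! ### Monoids with a length function. -/

section Length

variable {M : Type*} [CommMonoid M] (φ : M →* Multiplicative ℕ)

theorem IsAtomFactorization.card_le (hφ : ∀ x, φ x = 1 → x = 1) {m : M} {s : Multiset M}
    (h : IsAtomFactorization m s) : s.card ≤ (φ m).toAdd := by
  obtain ⟨hs, rfl⟩ := h
  induction s using Multiset.induction_on with
  | empty => simp
  | cons a s ih =>
    have h1 := ih fun b hb ↦ hs b (Multiset.mem_cons_of_mem hb)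
    have h2 : (φ a).toAdd ≠ 0 := fun h ↦ (hs a (Multiset.mem_cons_self a s)).1 (hφ a h)
    rw [Multiset.card_cons, Multiset.prod_cons, map_mul, toAdd_mul]
    omega

/-- A commutative monoid with a length function vanishing only at the identity is a bounded
factorization monoid. -/
theorem isBFM_of_monoidHom (hφ : ∀ x, φ x = 1 → x = 1) : IsBFM M := by
  refine ⟨?_, fun m ↦ (Set.finite_Iic (φ m).toAdd).subset ?_⟩
  · rw [IsAtomicMonoid, eq_top_iff]
    rintro m -
    induction hn : (φ m).toAdd using Nat.strong_induction_on generalizing m with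
    | _ n ih =>
      by_cases h1 : m = 1
      · rw [h1]
        exact one_mem _
      by_cases ha : IsMonoidAtom m
      · exact Submonoid.subset_closure ha
      simp only [IsMonoidAtom, not_and, not_forall, not_or] at ha
      obtain ⟨x, y, rfl, hx, hy⟩ := ha h1
      have hx' : (φ x).toAdd ≠ 0 := fun h ↦ hx (hφ x h)
      have hy' : (φ y).toAdd ≠ 0 := fun h ↦ hy (hφ y h)
      rw [map_mul, toAdd_mul] at hn
      -- Both factors have positive length, hence each is strictly shorter than the product.
      exact mul_mem (ih (φ x).toAdd (by omega) rfl) (ih (φ y).toAdd (by omega) rfl)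
  · rintro _ ⟨s, hs, rfl⟩
    exact hs.card_le φ hφ

end Length

end IntClosedIdeals

theorem mainTheorem5 (A : Type*) [CommRing A] [IsRegularLocalRing A] :
    IntClosedIdeals.IsBFM (IntClosedIdeals.IC A) ∧
    (∀ I J : Ideal A, IntClosedIdeals.adicOrder (I * J) =
      IntClosedIdeals.adicOrder I + IntClosedIdeals.adicOrder J) ∧
    (∀ I : Ideal A, IntClosedIdeals.adicOrder (IntClosedIdeals.intClosure I) =
      IntClosedIdeals.adicOrder I) ∧
    ∃ φ : IntClosedIdeals.IC A →* Multiplicative ℕ,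
      (∀ I : IntClosedIdeals.IC A,
        ((φ I).toAdd : ℕ∞) = IntClosedIdeals.adicOrder I.toIdeal) ∧
      ∀ (I : IntClosedIdeals.IC A) (s : Multiset (IntClosedIdeals.IC A)),
        IntClosedIdeals.IsAtomFactorization I s → s.card ≤ (φ I).toAdd :=
  ⟨IntClosedIdeals.isBFM_of_monoidHom (IntClosedIdeals.IC.order A) fun _ ↦
      IntClosedIdeals.IC.eq_one_of_order_eq_one,
    IntClosedIdeals.adicOrder_mul, IntClosedIdeals.adicOrder_intClosure,
    IntClosedIdeals.IC.order A, IntClosedIdeals.IC.coe_order,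
    fun _ _ h ↦ h.card_le _ fun _ ↦ IntClosedIdeals.IC.eq_one_of_order_eq_one⟩
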